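/- Let $d\ge 2$ be an integer and $\mathbb Z_d=\mathbb Z/d\mathbb Z$. Identify $\mathbb C^d$ with the functions $\mathbb Z_d\to\mathbb C$. For $f,g\in\mathbb C^d$ let $$V_gf(k,l)=\sum_{j=0}^{d-1} f_j\,\overline{g_{j-k}}\,e^{-2\pi i jl/d}\qquad (k,l\in\mathbb Z_d)$$ be the short-time Fourier transform (STFT) of $f$ with window $g$, with indices modulo $d$, and let $\operatorname{supp}(V_gg)$ be the set of $(k,l)\in\mathbb Z_d^2$ with $V_gg(k,l)\ne 0$. The window $g$ does STFT phase retrieval if, for all $f,\tilde f\in\mathbb C^d$, $|V_g\tilde f|=|V_gf|$ on $\mathbb Z_d^2$ implies $\tilde f=\gamma f$ for some $\gamma\in\mathbb C$ with $|\gamma|=1$. For integers $a\le b$ let $\{a,\dots,b\}\subseteq\mathbb Z_d$ be the set of residue classes of the integers $j$ with $a\le j\le b$. Put $m^*_d=\frac{d-1}{4}$ if $d$ is prime and $m^*_d=\frac{d-1}{3}$ otherwise, and for integers $m\geq 0$ $$\Omega_{d,m}=(\{-m,\dots,m\}\times\mathbb Z_d)\cup(\mathbb Z_d\times\{-m,\dots,m\}).$$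 (1) Let $d\ge2$, let $m>m^*_d$ be an integer, and let $g\in\mathbb C^d$ satisfy $\Omega_{d,m}\subseteq\operatorname{supp}(V_gg)$. Then $g$ does STFT phase retrieval. (2) For every $d\ge 6$ one can choose an integer $m=m_d$ with $m^*_d<m_d<\frac{d-1}{2}$ such that the set $M_d=\{m_d+1,\dots,d-(m_d+1)\}^2$ has the following properties. We have $\Omega_{d,m_d}=\mathbb Z_d^2\setminus M_d$, and every $g\in\mathbb C^d$ for which $V_gg$ has no zero outside $M_d$ does STFT phase retrieval. Moreover $$|M_d|\ge\Big(\frac{d-7}{3}\Big)^2,\qquad\text{and}\qquad |M_d|\ge\Big(\frac{d-5}{2}\Big)^2\ \text{ if } d \text{ is prime}.$$ The choice can be made so that $|M_d|/d^2\to\frac19$ as $d\to\infty$ through the non-primes and $|M_d|/d^2\to\frac14$ as $d\to\infty$ through the primes. -/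

import Mathlib

open Filter Topology

noncomputable section

namespace STFTPhase

/-- The short-time Fourier transform
`V_g f (k, l) = ∑_j f_j * conj (g_{j-k}) * exp (-2 π i j l / d)` of the signal `f` with respect to
the window `g`; signals and windows are functions on `ℤ/dℤ`. The ambiguity function of `g`
is `stft g g`. -/
def stft {d : ℕ} [NeZero d] (g f : ZMod d → ℂ) (p : ZMod d × ZMod d) : ℂ :=
  ∑ j : ZMod d, f j * (starRingEnd ℂ) (g (j - p.1)) *
    Complex.exp (-2 * (Real.pi : ℂ) * Complex.I * (j.val : ℂ) * (p.2.val : ℂ) / (d : ℂ))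

/-- `f` is phase retrievable with respect to `g`: every signal with the same STFT magnitudes
agrees with `f` up to a global phase factor. -/
def PhaseRetrievable {d : ℕ} [NeZero d] (g f : ZMod d → ℂ) : Prop :=
  ∀ f' : ZMod d → ℂ, (∀ p : ZMod d × ZMod d, ‖stft g f' p‖ = ‖stft g f p‖) →
    ∃ γ : ℂ, ‖γ‖ = 1 ∧ f' = γ • f

/-- The window `g` does (STFT) phase retrieval. -/
def DoesPhaseRetrieval {d : ℕ} [NeZero d] (g : ZMod d → ℂ) : Prop :=
  ∀ f : ZMod d → ℂ, PhaseRetrievable g f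

/-- The set `{a, …, b}` of residue classes modulo `d` of the integers `a ≤ j ≤ b`. -/
def indexRange (d : ℕ) (a b : ℤ) : Set (ZMod d) :=
  (fun j : ℤ => (j : ZMod d)) '' Set.Icc a b

/-- The "plus" `({-m, …, m} × ℤ_d) ∪ (ℤ_d × {-m, …, m})`. -/
def plusSet (d m : ℕ) : Set (ZMod d × ZMod d) :=
  (indexRange d (-(m : ℤ)) m ×ˢ Set.univ) ∪ (Set.univ ×ˢ indexRange d (-(m : ℤ)) m)

/-- The "hole" `{m + 1, …, d - (m + 1)}²`. -/
def holeSet (d m : ℕ) : Set (ZMod d × ZMod d) :=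
  indexRange d ((m : ℤ) + 1) ((d : ℤ) - ((m : ℤ) + 1)) ×ˢ
    indexRange d ((m : ℤ) + 1) ((d : ℤ) - ((m : ℤ) + 1))

open Classical in
/-- The threshold `m*`: `(d - 1) / 4` if `d` is prime and `(d - 1) / 3` otherwise. -/
def mStar (d : ℕ) : ℝ :=
  if d.Prime then ((d : ℝ) - 1) / 4 else ((d : ℝ) - 1) / 3

end STFTPhase

end

namespace STFTPhase

open Finset Polynomial

/-! ### Sparse polynomials in characteristic `p` and multiplicity at 1. -/

section Sparse

variable {k : Type*} [Field k]

/-! The Fourier transform of `|V_g f|²` is the product of the ambiguity functions of `f` and `g`, so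
the magnitudes determine `V_f f` wherever `V_g g ≠ 0`, here on the plus. Its vertical strip gives
the correlations of `f` of lag at most `m`, its horizontal strip those of the Fourier transform of
`f`.

Small lags fix the relative phase of nearby support points. Hence phase retrieval can fail only if
both `f` and its transform have supports cut by two disjoint cyclic gaps of length `m`
(`eq_phase_smul_or_gaps`), so both supports have at most `d - 2m` points. For prime `d` and `4m ≥ d`
this contradicts the uncertainty principle that the two support sizes add up to more than `d`. For
general `d` and `3m ≥ d`, the transform vanishes at `m` consecutive points while `f` has at most `m`
nonzero values, and a Vandermonde argument forces `f = 0`.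

Part (2) takes the least admissible `m`; the hole is the complement of the plus. -/

theorem coeff_X_mul_derivative_sub_C_mul (P : k[X]) (a i : ℕ) :
    (X * derivative P - C (a : k) * P).coeff i = ((i : k) - a) * P.coeff i := by
  rw [coeff_sub, coeff_C_mul]
  cases i with
  | zero => simp
  | succ i =>
    rw [coeff_X_mul, coeff_derivative]
    push_cast
    ring

/-- The operator `X P' - a P` costs at most one order of vanishing at 1, while it also kills the
coefficient at `a`; this trade drives the induction on sparsity. -/
theorem X_sub_one_pow_dvd_X_mul_derivative_sub {P : k[X]} {n : ℕ}
    (h : (X - 1) ^ (n + 1) ∣ P) (a : ℕ) :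
    (X - 1) ^ n ∣ X * derivative P - C (a : k) * P := by
  obtain ⟨Q, rfl⟩ := h
  refine dvd_sub (Dvd.dvd.mul_left ?_ _) (Dvd.dvd.mul_left ?_ _)
  · rw [derivative_mul]
    refine dvd_add (Dvd.dvd.mul_right ?_ _) (Dvd.dvd.mul_right (pow_dvd_pow _ n.le_succ) _)
    rw [derivative_pow]
    simp only [Nat.add_sub_cancel]
    exact Dvd.dvd.mul_right (dvd_mul_left _ _) _
  · exact Dvd.dvd.mul_right (pow_dvd_pow _ n.le_succ) _

/-- In characteristic `p`, a polynomial of degree less than `p` with at most `n` nonzero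
coefficients cannot have a zero of multiplicity `n` at `1` unless it vanishes. -/
theorem eq_zero_of_X_sub_one_pow_dvd (p : ℕ) [CharP k p] (n : ℕ) :
    ∀ P : k[X], (∀ i ∈ P.support, i < p) → P.support.card ≤ n → (X - 1) ^ n ∣ P → P = 0 := by
  induction n with
  | zero =>
    intro P _ hc _
    simpa using hc
  | succ n ih =>
    intro P hdeg hc hdvd
    by_contra hP
    obtain ⟨a, ha⟩ := nonempty_support_iff.mpr hP
    have hsupp : (X * derivative P - C (a : k) * P).support ⊆ P.support.erase a := by
      intro i hi
      rw [mem_support_iff, coeff_X_mul_derivative_sub_C_mul] at hi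
      refine mem_erase.mpr ⟨?_, mem_support_iff.mpr (right_ne_zero_of_mul hi)⟩
      rintro rfl
      simp at hi
    have hzero := ih _ (fun i hi => hdeg i (mem_of_mem_erase (hsupp hi)))
      ((card_le_card hsupp).trans (by rw [card_erase_of_mem ha]; omega))
      (X_sub_one_pow_dvd_X_mul_derivative_sub hdvd a)
    -- Exponents below `p` stay distinct modulo `p`, so `(i - a) P_i = 0` leaves only the
    -- coefficient at `a`.
    have hmono : P = monomial a (P.coeff a) := by
      ext i
      rw [coeff_monomial]
      split_ifs with hai
      · rw [hai]
      · by_contra hi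
        have h0 := coeff_X_mul_derivative_sub_C_mul P a i
        rw [hzero, coeff_zero, eq_comm, mul_eq_zero, or_iff_left hi, sub_eq_zero] at h0
        have hmod := (CharP.natCast_eq_natCast k p).mp h0
        exact hai (Nat.ModEq.eq_of_lt_of_lt hmod (hdeg i (mem_support_iff.mpr hi))
          (hdeg a ha)).symm
    have heval : P.eval 1 = 0 := by
      obtain ⟨Q, rfl⟩ := hdvd
      simp
    rw [hmono, eval_monomial, one_pow, mul_one] at heval
    exact mem_support_iff.mp ha heval

end Sparse

/-! ### Uncertainty principles on the cyclic group. -/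

/-- There is a valuation subring of `ℂ` whose residue field has characteristic `p`. -/
theorem exists_valuationSubring_residue_charP (p : ℕ) [hp : Fact p.Prime] :
    ∃ V : ValuationSubring ℂ, CharP (IsLocalRing.ResidueField V) p := by
  let A : Subring ℂ := (Int.castRingHom ℂ).range
  let e : ℤ ≃+* A := RingEquiv.ofBijective (Int.castRingHom ℂ).rangeRestrict
    ⟨fun a b h => by
      have := congrArg Subtype.val h
      simpa using this, (Int.castRingHom ℂ).rangeRestrict_surjective⟩
  have hne : Ideal.span {e (p : ℤ)} ≠ ⊤ := by
    rw [Ne, Ideal.span_singleton_eq_top]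
    intro h
    have h1 := (MulEquiv.isUnit_map e).mp h
    exact (Nat.prime_iff_prime_int.mp hp.out).not_isUnit h1
  -- The proper ideal `(p)` of `ℤ ⊆ ℂ` lies in the nonunits of some valuation ring of `ℂ`.
  obtain ⟨V, -, hV⟩ := Ideal.image_subset_nonunits_valuationSubring _ hne
  refine ⟨V, ?_⟩
  have hmem : (p : ℂ) ∈ V.nonunits :=
    hV ⟨e p, Ideal.subset_span rfl, by simp [e]⟩
  have h0 : ((p : ℕ) : IsLocalRing.ResidueField V) = 0 := by
    have h1 : IsLocalRing.residue V (p : V) = 0 := by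
      rw [IsLocalRing.residue_eq_zero_iff]
      exact V.coe_mem_nonunits_iff.mp (by simpa using hmem)
    simpa using h1
  exact ringChar.of_eq (CharP.ringChar_of_prime_eq_zero hp.out h0)

open scoped ZMod
open ZMod (stdAddChar)

theorem stdAddChar_neg_mul_eq_pow {d : ℕ} [NeZero d] (j l : ZMod d) :
    (stdAddChar (-(j * l)) : ℂ) = stdAddChar (-l) ^ j.val := by
  rw [← AddChar.map_nsmul_eq_pow, nsmul_eq_mul, ZMod.natCast_zmod_val, mul_neg]

theorem stdAddChar_ne_zero {d : ℕ} [NeZero d] (j : ZMod d) : (stdAddChar j : ℂ) ≠ 0 := by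
  rw [ZMod.stdAddChar_apply]
  exact Circle.coe_ne_zero _

/-- The uncertainty principle on `ℤ/pℤ`, in the form: a nonzero function has more nonzero values
than its Fourier transform has zeros. -/
theorem card_dft_zeros_lt_card_support {p : ℕ} [hp : Fact p.Prime] {f : ZMod p → ℂ} (hf : f ≠ 0) :
    #{l | ZMod.dft f l = 0} < #{j | f j ≠ 0} := by
  by_contra! hcard
  obtain ⟨V, hV⟩ := exists_valuationSubring_residue_charP p
  -- Dividing by a value of maximal valuation makes all coefficients integral and one of them 1, so
  -- the reduction is nonzero.
  obtain ⟨j₀, -, hj₀⟩ := exists_max_image univ (fun j => V.valuation (f j)) univ_nonempty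
  have hfj₀ : f j₀ ≠ 0 := by
    intro h
    apply hf
    ext j
    have := hj₀ j (mem_univ j)
    rw [h, map_zero, nonpos_iff_eq_zero, map_eq_zero] at this
    exact this
  have hc : ∀ j, f j / f j₀ ∈ V := fun j => by
    rw [← V.valuation_le_one_iff, map_div₀]
    exact div_le_one_of_le₀ (hj₀ j (mem_univ j)) zero_le
  have hω_pow : ∀ l : ZMod p, (stdAddChar l : ℂ) ^ p = 1 := fun l => by
    rw [← AddChar.map_nsmul_eq_pow, nsmul_eq_mul, CharP.cast_eq_zero, zero_mul,
      AddChar.map_zero_eq_one]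
  have hω : ∀ l : ZMod p, (stdAddChar (-l) : ℂ) ∈ V := fun l => by
    rw [← V.valuation_le_one_iff]
    refine le_of_eq ((pow_eq_one_iff_of_nonneg zero_le hp.out.ne_zero).mp ?_)
    rw [← map_pow, hω_pow, map_one]
  let c : ZMod p → V := fun j => ⟨f j / f j₀, hc j⟩
  let ω : ZMod p → V := fun l => ⟨stdAddChar (-l), hω l⟩
  have hω_inj : Function.Injective ω := fun a b hab => by
    have h : (stdAddChar (-a) : ℂ) = stdAddChar (-b) := by
      simpa only [ω, Subtype.mk.injEq] using hab
    exact neg_injective (ZMod.injective_stdAddChar h)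
  let P : V[X] := ∑ j, monomial j.val (c j)
  have hcoeff : ∀ j : ZMod p, P.coeff j.val = c j := fun j => by
    simp only [P, finsetSum_coeff, coeff_monomial, (ZMod.val_injective p).eq_iff]
    simp
  have hcoeff_ge : ∀ i, p ≤ i → P.coeff i = 0 := fun i hi => by
    simp only [P, finsetSum_coeff, coeff_monomial]
    refine sum_eq_zero fun j _ => if_neg ?_
    have := ZMod.val_lt j
    omega
  have hroot : ∀ l, ZMod.dft f l = 0 → P.eval (ω l) = 0 := fun l hl => by
    apply Subtype.val_injective
    have : ((P.eval (ω l) : V) : ℂ) = (f j₀)⁻¹ * ZMod.dft f l := by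
      simp only [P, eval_finsetSum, eval_monomial, ZMod.dft_apply, mul_sum]
      rw [AddSubmonoidClass.coe_finsetSum]
      refine sum_congr rfl fun j _ => ?_
      simp only [c, ω, MulMemClass.coe_mul, SubmonoidClass.coe_pow, stdAddChar_neg_mul_eq_pow,
        smul_eq_mul]
      ring
    rw [this, hl, mul_zero]
    rfl
  have hP : P ≠ 0 := fun h => by
    have h1 := hcoeff j₀
    rw [h, coeff_zero] at h1
    have h2 := congrArg Subtype.val h1
    simp [c, hfj₀] at h2
  have hdvd : (∏ l ∈ univ.filter (fun l => ZMod.dft f l = 0), (X - C (ω l))) ∣ P := by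
    have := (Multiset.prod_X_sub_C_dvd_iff_le_roots hP
      ((univ.filter (fun l => ZMod.dft f l = 0)).val.map ω)).mpr ?_
    · simpa [Finset.prod] using this
    · rw [Multiset.le_iff_subset (Multiset.Nodup.map hω_inj (Finset.nodup _))]
      intro x hx
      obtain ⟨l, hl, rfl⟩ := Multiset.mem_map.mp hx
      exact (mem_roots hP).mpr (hroot l (by simpa using hl))
  let π := IsLocalRing.residue V
  -- In characteristic `p`, `(x - 1)^p = x^p - 1`: all `p`-th roots of unity reduce to 1, and
  -- distinct roots of `P` merge into a multiple root at 1.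
  have hπω : ∀ l, π (ω l) = 1 := fun l => by
    have h1 : ω l ^ p = 1 := Subtype.ext (hω_pow _)
    have h2 : (π (ω l) - 1) ^ p = 0 := by
      rw [sub_pow_char, ← map_pow, h1, map_one, one_pow, sub_self]
    exact sub_eq_zero.mp (eq_zero_of_pow_eq_zero h2)
  have hsupp : (P.map π).support ⊆ (univ.filter (fun j => f j ≠ 0)).image ZMod.val := by
    intro i hi
    rw [mem_support_iff, coeff_map] at hi
    have hi' : P.coeff i ≠ 0 := fun h => hi (by rw [h, map_zero])
    have hip : i < p := not_le.mp fun h => hi' (hcoeff_ge i h)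
    have hv : ((i : ZMod p)).val = i := ZMod.val_cast_of_lt hip
    refine mem_image.mpr ⟨i, mem_filter.mpr ⟨mem_univ _, fun h => hi' ?_⟩, hv⟩
    rw [← hv, hcoeff]
    exact Subtype.ext (by simp [c, h])
  have hmap := Polynomial.map_dvd π hdvd
  simp only [Polynomial.map_prod, Polynomial.map_sub, map_X, map_C, hπω, prod_const, map_one]
    at hmap
  have hzero := eq_zero_of_X_sub_one_pow_dvd p _ (P.map π)
    (fun i hi => by
      obtain ⟨j, -, rfl⟩ := mem_image.mp (hsupp hi)
      exact ZMod.val_lt j)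
    (((card_le_card hsupp).trans card_image_le).trans hcard) hmap
  have h1 : (P.map π).coeff j₀.val = 1 := by
    rw [coeff_map, hcoeff]
    have : c j₀ = 1 := Subtype.ext (div_self hfj₀)
    rw [this, map_one]
  rw [hzero, coeff_zero] at h1
  exact zero_ne_one h1

/-- If the Fourier transform of `f` vanishes at `m` consecutive points and `f` has at most `m`
nonzero values, then `f = 0`. -/
theorem eq_zero_of_dft_consecutive_zeros {d m : ℕ} [NeZero d] {f : ZMod d → ℂ}
    (hcard : #{j | f j ≠ 0} ≤ m) (l₀ : ZMod d)
    (hzero : ∀ i : ℕ, i < m → ZMod.dft f (l₀ + i) = 0) : f = 0 := by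
  -- Consecutive zeros say that the modulated `f` annihilates all polynomials of degree below `m` in
  -- the nodes.
  have hpoly : ∀ q : ℂ[X], q.natDegree < m →
      ∑ j, f j * stdAddChar (-(j * l₀)) * q.eval (stdAddChar (-j)) = 0 := by
    intro q hq
    calc ∑ j, f j * stdAddChar (-(j * l₀)) * q.eval (stdAddChar (-j))
        = ∑ i ∈ range m, q.coeff i * ZMod.dft f (l₀ + i) := by
          simp only [eval_eq_sum_range' hq, ZMod.dft_apply, mul_sum]
          rw [sum_comm]
          refine sum_congr rfl fun i _ => sum_congr rfl fun j _ => ?_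
          rw [← AddChar.map_nsmul_eq_pow, mul_add, neg_add, AddChar.map_add_eq_mul,
            nsmul_eq_mul, smul_eq_mul, mul_neg, mul_comm (i : ZMod d)]
          ring
      _ = 0 := sum_eq_zero fun i hi => by rw [hzero i (mem_range.mp hi), mul_zero]
  ext j₀
  by_contra hj₀
  have hj₀' : f j₀ ≠ 0 := hj₀
  set S : Finset (ZMod d) := univ.filter (fun j => f j ≠ 0) with hS
  have hmem : j₀ ∈ S := by simp [hS, hj₀']
  -- Lagrange-type polynomial isolating `j₀` within the support.
  let q : ℂ[X] := ∏ j ∈ S.erase j₀, (X - C (stdAddChar (-j) : ℂ))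
  have hdeg : q.natDegree < m := by
    rw [natDegree_prod_of_monic _ _ fun j _ => monic_X_sub_C _]
    simp only [natDegree_X_sub_C, sum_const, smul_eq_mul, mul_one]
    exact (card_erase_lt_of_mem hmem).trans_le hcard
  have h := hpoly q hdeg
  have hsingle : ∀ j, j ≠ j₀ →
      f j * stdAddChar (-(j * l₀)) * q.eval (stdAddChar (-j) : ℂ) = 0 := by
    intro j hj
    by_cases hfj : f j = 0
    · simp [hfj]
    · rw [eval_prod, prod_eq_zero (mem_erase.mpr ⟨hj, by simp [hS, hfj]⟩), mul_zero]
      simp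
  rw [Fintype.sum_eq_single j₀ hsingle] at h
  refine mul_ne_zero (mul_ne_zero hj₀' (stdAddChar_ne_zero _)) ?_ h
  rw [eval_prod, prod_ne_zero_iff]
  intro j hj
  rw [eval_sub, eval_X, eval_C, sub_ne_zero]
  intro h'
  have := ZMod.injective_stdAddChar h'
  exact (mem_erase.mp hj).1 (neg_injective this).symm

end STFTPhase

/-! ### Propagation of phase through short-lag correlations. -/

namespace STFTPhase

open Finset
open ZMod (stdAddChar)
open scoped ComplexConjugate

/-- If `T` propagates along `U` over distances at most `m`, holds at `0` and fails at a point `N`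
of `U`, then `U` has a gap of length `m` between `0` and `N`. -/
theorem exists_gap_of_propagates {m N : ℕ} {T U : ℕ → Prop}
    (hprop : ∀ n n', n ≤ n' → n' ≤ n + m → T n → U n' → T n')
    (h0 : T 0) (hN : U N) (hTN : ¬ T N) :
    ∃ n, n + m < N ∧ ∀ i ∈ Ioc n (n + m), ¬ U i := by
  classical
  set n := Nat.findGreatest T N with hn
  have hT : T n := Nat.findGreatest_spec (Nat.zero_le N) h0
  have hnN : n ≤ N := Nat.findGreatest_le N
  have hlt : n + m < N := by
    by_contra! h
    exact hTN (hprop n N hnN h hT hN)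
  refine ⟨n, hlt, fun i hi hU => ?_⟩
  rw [mem_Ioc] at hi
  exact Nat.findGreatest_is_greatest hi.1 (by omega) (hprop n i hi.1.le hi.2 hT hU)

theorem zmod_natCast_injOn (d : ℕ) [NeZero d] (a : ZMod d) :
    Set.InjOn (fun i : ℕ => a + (i : ZMod d)) (Set.Iio d) := by
  intro i hi j hj h
  have h' : (i : ZMod d) = j := add_left_cancel h
  rw [ZMod.natCast_eq_natCast_iff] at h'
  exact Nat.ModEq.eq_of_lt_of_lt h' hi hj

theorem natCast_mem_indexRange {d m i : ℕ} (hi : i ≤ m) :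
    (i : ZMod d) ∈ indexRange d (-(m : ℤ)) m :=
  ⟨i, ⟨by omega, by omega⟩, by simp⟩

/-- Two functions on `ℤ/dℤ` with the same correlations of lag at most `m` agree up to a global
phase, unless their support is interrupted by two disjoint gaps of length `m`. -/
theorem eq_phase_smul_or_gaps {d m : ℕ} [NeZero d] {F F' : ZMod d → ℂ}
    (h : ∀ k ∈ indexRange d (-(m : ℤ)) m, ∀ j,
      F' j * conj (F' (j - k)) = F j * conj (F (j - k))) :
    (∃ γ : ℂ, ‖γ‖ = 1 ∧ F' = γ • F) ∨
      (F ≠ 0 ∧ #{j | F j ≠ 0} + 2 * m ≤ d ∧ ∃ a : ZMod d, ∀ i : ℕ, i < m → F (a + i) = 0) := by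
  have hnorm : ∀ j, ‖F' j‖ = ‖F j‖ := fun j => by
    have h0 := h 0 (by simpa using natCast_mem_indexRange (d := d) (Nat.zero_le m)) j
    rw [sub_zero, Complex.mul_conj', Complex.mul_conj'] at h0
    have h1 : ‖F' j‖ ^ 2 = ‖F j‖ ^ 2 := by exact_mod_cast h0
    exact (sq_eq_sq₀ (norm_nonneg _) (norm_nonneg _)).mp h1
  have hr_norm : ∀ j, F j ≠ 0 → ‖F' j / F j‖ = 1 := fun j hj => by
    rw [norm_div, hnorm, div_self (norm_ne_zero_iff.mpr hj)]
  -- The ratio `F' / F` is unimodular by lag 0, and lag `i` makes it agree at support points at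
  -- distance `i`.
  have hr : ∀ (j : ZMod d) (i : ℕ), i ≤ m → F j ≠ 0 → F (j + i) ≠ 0 →
      F' (j + i) / F (j + i) = F' j / F j := fun j i hi hj hji => by
    have h1 := h i (natCast_mem_indexRange hi) (j + i)
    rw [add_sub_cancel_right] at h1
    have h2 : (F' (j + i) / F (j + i)) * conj (F' j / F j) = 1 := by
      rw [map_div₀, div_mul_div_comm, h1, div_self]
      exact mul_ne_zero hji ((map_ne_zero _).mpr hj)
    have h3 : (F' j / F j) * conj (F' j / F j) = 1 := by
      rw [Complex.mul_conj', hr_norm j hj]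
      norm_num
    exact mul_right_cancel₀ (right_ne_zero_of_mul_eq_one h3) (h2.trans h3.symm)
  have hzero : ∀ j, F j = 0 → F' j = 0 := fun j hj => by
    rw [← norm_eq_zero, hnorm, hj, norm_zero]
  by_cases hconst : ∀ a b, F a ≠ 0 → F b ≠ 0 → F' b / F b = F' a / F a
  · left
    by_cases hF : ∃ a, F a ≠ 0
    · obtain ⟨a, ha⟩ := hF
      refine ⟨F' a / F a, hr_norm a ha, funext fun j => ?_⟩
      rw [Pi.smul_apply, smul_eq_mul]
      by_cases hj : F j = 0
      · rw [hj, mul_zero, hzero j hj]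
      · rw [← hconst a j ha hj, div_mul_cancel₀ _ hj]
    · push Not at hF
      exact ⟨1, norm_one, funext fun j => by simp [hF j, hzero j (hF j)]⟩
  · right
    push Not at hconst
    obtain ⟨a, b, ha, hb, hab⟩ := hconst
    have hgap : ∀ a b : ZMod d, F a ≠ 0 → F b ≠ 0 → F' b / F b ≠ F' a / F a →
        ∃ n, n + m < (b - a).val ∧ ∀ i ∈ Ioc n (n + m), F (a + (i : ℕ)) = 0 := by
      intro a b ha hb hab
      obtain ⟨n, hn, hn'⟩ := exists_gap_of_propagates (m := m) (N := (b - a).val)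
        (T := fun n => F (a + n) ≠ 0 ∧ F' (a + n) / F (a + n) = F' a / F a)
        (U := fun n => F (a + n) ≠ 0)
        (fun n n' hle hle' hT hU => ⟨hU, by
          obtain ⟨i, rfl⟩ := Nat.exists_eq_add_of_le hle
          rw [Nat.cast_add, ← add_assoc] at hU ⊢
          rw [hr (a + n) i (by omega) hT.1 hU, hT.2]⟩)
        (by simpa using ha) (by simpa using hb) (by simp [hab])
      exact ⟨n, hn, fun i hi => not_not.mp (hn' i hi)⟩
    -- Each of the two arcs of the circle between `a` and `b` must contain a gap.
    obtain ⟨n, hn, hFn⟩ := hgap a b ha hb hab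
    obtain ⟨n', hn', hFn'⟩ := hgap b a hb ha (Ne.symm hab)
    have hne : b - a ≠ 0 := fun h0 => hab (by rw [sub_eq_zero.mp h0])
    have hval : (a - b).val = d - (b - a).val := by
      have : NeZero (b - a) := ⟨hne⟩
      rw [← neg_sub b a, ZMod.val_neg_of_ne_zero]
    set N := (b - a).val with hN
    have hNd : N < d := ZMod.val_lt _
    have hb' : b = a + (N : ℕ) := by rw [hN, ZMod.natCast_zmod_val]; ring
    refine ⟨fun h0 => ha (congrFun h0 a), ?_, a + (n + 1 : ℕ), fun i hi => ?_⟩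
    -- Measured from `a`, the first gap ends before `N` and the second lies strictly between `N` and
    -- `d`, so nothing wraps around.
    · have hdisj : Disjoint (Ioc n (n + m)) (Ioc (N + n') (N + n' + m)) := by
        rw [disjoint_left]
        intro i hi hi'
        rw [mem_Ioc] at hi hi'
        omega
      have hsub : (Ioc n (n + m) ∪ Ioc (N + n') (N + n' + m)).image
          (fun i : ℕ => a + (i : ZMod d)) ⊆ univ.filter (fun j => ¬ F j ≠ 0) := by
        intro j hj
        obtain ⟨i, hi, rfl⟩ := mem_image.mp hj
        rw [mem_filter, not_not]
        refine ⟨mem_univ _, ?_⟩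
        rcases mem_union.mp hi with hi | hi
        · exact hFn i hi
        · rw [mem_Ioc] at hi
          have h1 := hFn' (i - N) (mem_Ioc.mpr ⟨by omega, by omega⟩)
          rwa [hb', add_assoc, ← Nat.cast_add, Nat.add_sub_cancel' (by omega)] at h1
      have hcard := card_le_card hsub
      rw [card_image_of_injOn, card_union_of_disjoint hdisj, Nat.card_Ioc, Nat.card_Ioc] at hcard
      · have htot := card_filter_add_card_filter_not (s := (univ : Finset (ZMod d)))
          (fun j => F j ≠ 0)
        rw [card_univ, ZMod.card] at htot
        omega
      · refine (zmod_natCast_injOn d a).mono fun i hi => ?_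
        rw [mem_coe, mem_union, mem_Ioc, mem_Ioc] at hi
        rw [Set.mem_Iio]
        omega
    · rw [add_assoc, ← Nat.cast_add]
      exact hFn _ (mem_Ioc.mpr ⟨by omega, by omega⟩)

/-! ### Ambiguity functions and correlations. -/

theorem stft_eq_dft {d : ℕ} [NeZero d] (g f : ZMod d → ℂ) (k l : ZMod d) :
    stft g f (k, l) = ∑ j, f j * conj (g (j - k)) * stdAddChar (-(j * l)) := by
  refine sum_congr rfl fun j _ => ?_
  have h : -(j * l) = ((-(j.val * l.val : ℤ) : ℤ) : ZMod d) := by simp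
  rw [h, ZMod.stdAddChar_coe]
  congr 2
  push_cast
  ring

theorem conj_stdAddChar {d : ℕ} [NeZero d] (j : ZMod d) :
    conj (stdAddChar j : ℂ) = stdAddChar (-j) := by
  rw [ZMod.stdAddChar_apply, ZMod.stdAddChar_apply, AddChar.map_neg_eq_inv, Circle.coe_inv_eq_conj]

theorem sum_stdAddChar_mul {d : ℕ} [NeZero d] (b : ZMod d) :
    ∑ l : ZMod d, (stdAddChar (l * b) : ℂ) = if b = 0 then (d : ℂ) else 0 := by
  have h := AddChar.sum_mulShift b (ZMod.isPrimitive_stdAddChar d)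
  rw [ZMod.card] at h
  rw [h]
  split_ifs <;> simp

/-- The Fourier transform of the spectrogram is the product of the ambiguity functions. -/
theorem sum_norm_stft_sq_mul {d : ℕ} [NeZero d] (g f : ZMod d → ℂ) (a b : ZMod d) :
    ∑ k, ∑ l, ((‖stft g f (k, l)‖ : ℂ) ^ 2) * (stdAddChar (-(k * a)) * stdAddChar (l * b)) =
      d * (stft f f (b, a) * conj (stft g g (b, a))) := by
  have hinner : ∀ k : ZMod d,
      ∑ l, ((‖stft g f (k, l)‖ : ℂ) ^ 2) * (stdAddChar (-(k * a)) * stdAddChar (l * b)) =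
      d * ∑ j, stdAddChar (-(k * a)) * (f j * conj (f (j - b))) *
        (conj (g (j - k)) * g (j - b - k)) := by
    intro k
    have hexp : ∀ l : ZMod d, ((‖stft g f (k, l)‖ : ℂ) ^ 2) *
        (stdAddChar (-(k * a)) * stdAddChar (l * b)) =
        ∑ j, ∑ i, stdAddChar (-(k * a)) * (f j * conj (f i)) * (conj (g (j - k)) * g (i - k)) *
          stdAddChar (l * (b - (j - i))) := by
      intro l
      rw [← Complex.mul_conj', stft_eq_dft, map_sum, sum_mul_sum, sum_mul]
      refine sum_congr rfl fun j _ => ?_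
      rw [sum_mul]
      refine sum_congr rfl fun i _ => ?_
      have h1 : l * (b - (j - i)) = -(j * l) + i * l + l * b := by ring
      rw [h1, AddChar.map_add_eq_mul, AddChar.map_add_eq_mul]
      simp only [map_mul, conj_stdAddChar, neg_neg, Complex.conj_conj]
      ring
    simp only [hexp]
    rw [sum_comm, mul_sum]
    refine sum_congr rfl fun j _ => ?_
    -- Orthogonality of characters in `l` leaves only `i = j - b`.
    rw [sum_comm, Fintype.sum_eq_single (j - b)]
    · rw [← mul_sum, sum_stdAddChar_mul, if_pos (by ring)]
      ring
    · intro i hi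
      rw [← mul_sum, sum_stdAddChar_mul, if_neg, mul_zero]
      intro h0
      exact hi (by linear_combination h0)
  simp only [hinner]
  rw [← mul_sum, sum_comm, stft_eq_dft, stft_eq_dft, map_sum, sum_mul]
  congr 1
  refine sum_congr rfl fun j _ => ?_
  -- Substituting `k = j - t` separates the sum over `f` from the sum over `g`.
  rw [mul_sum, ← Equiv.sum_comp (Equiv.subLeft j)]
  refine sum_congr rfl fun t _ => ?_
  simp only [Equiv.subLeft_apply, map_mul, conj_stdAddChar, neg_neg, Complex.conj_conj]
  have h1 : -((j - t) * a) = -(j * a) + t * a := by ring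
  have h2 : j - b - (j - t) = t - b := by ring
  rw [h1, h2, sub_sub_cancel, AddChar.map_add_eq_mul]
  ring

theorem ambiguity_eq_of_norm_stft_eq {d : ℕ} [NeZero d] {g f f' : ZMod d → ℂ}
    (h : ∀ p, ‖stft g f' p‖ = ‖stft g f p‖) {p : ZMod d × ZMod d} (hp : stft g g p ≠ 0) :
    stft f' f' p = stft f f p := by
  obtain ⟨b, a⟩ := p
  have h1 := sum_norm_stft_sq_mul g f' a b
  simp only [h] at h1
  rw [sum_norm_stft_sq_mul g f a b] at h1
  have h2 := mul_left_cancel₀ (Nat.cast_ne_zero.mpr (NeZero.ne d)) h1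
  exact (mul_right_cancel₀ ((map_ne_zero _).mpr hp) h2).symm

/-- For fixed `k` the ambiguity function is the Fourier transform of the lag-`k` correlation, and
that transform is injective. -/
theorem correlation_eq_of_ambiguity_eq {d : ℕ} [NeZero d] {f f' : ZMod d → ℂ} {k : ZMod d}
    (h : ∀ l, stft f' f' (k, l) = stft f f (k, l)) (j : ZMod d) :
    f' j * conj (f' (j - k)) = f j * conj (f (j - k)) := by
  have h1 : ZMod.dft (fun j => f' j * conj (f' (j - k))) =
      ZMod.dft (fun j => f j * conj (f (j - k))) := by
    ext l
    have := h l
    rw [stft_eq_dft, stft_eq_dft] at this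
    simpa only [ZMod.dft_apply, smul_eq_mul, mul_comm] using this
  exact congrFun (ZMod.dft.injective h1) j

/-- The Fourier transform of the ambiguity function in its first variable is a correlation of the
Fourier transform. -/
theorem sum_stft_self_mul {d : ℕ} [NeZero d] (f : ZMod d → ℂ) (l q : ZMod d) :
    ∑ k, stft f f (k, l) * stdAddChar (-(k * (q - l))) =
      ZMod.dft f q * conj (ZMod.dft f (q - l)) := by
  simp only [stft_eq_dft, ZMod.dft_apply, smul_eq_mul, map_sum, sum_mul_sum]
  simp only [sum_mul]
  rw [sum_comm]
  refine sum_congr rfl fun j _ => ?_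
  rw [← Equiv.sum_comp (Equiv.subLeft j)]
  refine sum_congr rfl fun t _ => ?_
  simp only [Equiv.subLeft_apply, map_mul, conj_stdAddChar, neg_neg, sub_sub_cancel]
  have h1 : -((j - t) * (q - l)) = -(j * q) + j * l + t * (q - l) := by ring
  have h2 : (stdAddChar (j * l) : ℂ) * stdAddChar (-(j * l)) = 1 := by
    rw [← AddChar.map_add_eq_mul, add_neg_cancel, AddChar.map_zero_eq_one]
  rw [h1, AddChar.map_add_eq_mul, AddChar.map_add_eq_mul]
  linear_combination (f j * conj (f t) * stdAddChar (-(j * q)) * stdAddChar (t * (q - l))) * h2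

theorem dft_correlation_eq_of_ambiguity_eq {d : ℕ} [NeZero d] {f f' : ZMod d → ℂ} {l : ZMod d}
    (h : ∀ k, stft f' f' (k, l) = stft f f (k, l)) (q : ZMod d) :
    ZMod.dft f' q * conj (ZMod.dft f' (q - l)) = ZMod.dft f q * conj (ZMod.dft f (q - l)) := by
  rw [← sum_stft_self_mul, ← sum_stft_self_mul]
  simp only [h]

/-! ### Phase retrieval from the plus. -/

theorem four_mul_ge_of_prime {d m : ℕ} (hd : d.Prime) (hm : mStar d < m) : d ≤ 4 * m := by
  rw [mStar, if_pos hd, div_lt_iff₀ (by norm_num)] at hm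
  have : (d : ℝ) < ((4 * m + 1 : ℕ) : ℝ) := by push_cast; linarith
  exact Nat.lt_succ_iff.mp (by exact_mod_cast this)

theorem three_mul_ge_of_not_prime {d m : ℕ} (hd : ¬ d.Prime) (hm : mStar d < m) : d ≤ 3 * m := by
  rw [mStar, if_neg hd, div_lt_iff₀ (by norm_num)] at hm
  have : (d : ℝ) < ((3 * m + 1 : ℕ) : ℝ) := by push_cast; linarith
  exact Nat.lt_succ_iff.mp (by exact_mod_cast this)

/-- A window whose ambiguity function has no zero on the plus does phase retrieval. -/
theorem doesPhaseRetrieval_of_plusSet_subset {d m : ℕ} [NeZero d] (hm : mStar d < m)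
    {g : ZMod d → ℂ} (hg : plusSet d m ⊆ Function.support (stft g g)) :
    DoesPhaseRetrieval g := by
  intro f f' h
  have hA : ∀ p ∈ plusSet d m, stft f' f' p = stft f f p := fun p hp =>
    ambiguity_eq_of_norm_stft_eq h (hg hp)
  rcases eq_phase_smul_or_gaps (F := f) (F' := f') (m := m) (fun k hk =>
    correlation_eq_of_ambiguity_eq fun l => hA _ (Or.inl ⟨hk, trivial⟩)) with
    hγ | ⟨hf, hcard, -⟩
  · exact hγ
  rcases eq_phase_smul_or_gaps (F := ZMod.dft f) (F' := ZMod.dft f') (m := m) (fun l hl =>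
    dft_correlation_eq_of_ambiguity_eq fun k => hA _ (Or.inr ⟨trivial, hl⟩)) with
    ⟨γ, hγ, hff'⟩ | ⟨-, hcard', l₀, hl₀⟩
  · refine ⟨γ, hγ, ZMod.dft.injective ?_⟩
    rw [hff', map_smul]
  exfalso
  -- Prime case: the supports add up to at most `2d - 4m ≤ d`. Otherwise `f` has at most `d - 2m ≤
  -- m` nonzero values.
  by_cases hd : d.Prime
  · have : Fact d.Prime := ⟨hd⟩
    have hdm := four_mul_ge_of_prime hd hm
    have hlt := card_dft_zeros_lt_card_support hf
    have htot := card_filter_add_card_filter_not (s := (univ : Finset (ZMod d)))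
      (fun l => ZMod.dft f l = 0)
    rw [card_univ, ZMod.card] at htot
    simp only [ne_eq] at hcard' hcard hlt
    omega
  · have hdm := three_mul_ge_of_not_prime hd hm
    exact hf (eq_zero_of_dft_consecutive_zeros (by omega) l₀ hl₀)

end STFTPhase

/-! ### Size of the hole and its asymptotics. -/

namespace STFTPhase

theorem mem_indexRange_hole_iff {d m : ℕ} [NeZero d] (z : ZMod d) :
    z ∈ indexRange d ((m : ℤ) + 1) ((d : ℤ) - ((m : ℤ) + 1)) ↔
      m + 1 ≤ z.val ∧ z.val + (m + 1) ≤ d := by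
  constructor
  · rintro ⟨j, ⟨hj, hj'⟩, rfl⟩
    have hval : (((j : ℤ) : ZMod d).val : ℤ) = j := by
      rw [ZMod.val_intCast]
      exact Int.emod_eq_of_lt (by omega) (by omega)
    simp only
    omega
  · intro h
    exact ⟨z.val, ⟨by omega, by omega⟩, by simp⟩

theorem mem_indexRange_plus_iff {d m : ℕ} [NeZero d] (hm : 2 * m + 1 ≤ d) (z : ZMod d) :
    z ∈ indexRange d (-(m : ℤ)) m ↔ z.val ≤ m ∨ d ≤ z.val + m := by
  constructor
  · rintro ⟨j, ⟨hj, hj'⟩, rfl⟩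
    simp only
    rcases le_or_gt 0 j with h0 | h0
    · have hval : (((j : ℤ) : ZMod d).val : ℤ) = j := by
        rw [ZMod.val_intCast]
        exact Int.emod_eq_of_lt (by omega) (by omega)
      omega
    · have hval : (((j : ℤ) : ZMod d).val : ℤ) = j + d := by
        rw [ZMod.val_intCast, ← Int.add_emod_right]
        exact Int.emod_eq_of_lt (by omega) (by omega)
      omega
  · have hlt := ZMod.val_lt z
    rintro (h | h)
    · exact ⟨z.val, ⟨by omega, by omega⟩, by simp⟩
    · exact ⟨z.val - d, ⟨by omega, by omega⟩, by simp⟩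

theorem plusSet_eq_compl_holeSet {d m : ℕ} [NeZero d] (hm : 2 * m + 1 ≤ d) :
    plusSet d m = (holeSet d m)ᶜ := by
  ext ⟨k, l⟩
  simp only [plusSet, holeSet, Set.mem_union, Set.mem_prod, Set.mem_univ, and_true, true_and,
    Set.mem_compl_iff, mem_indexRange_hole_iff, mem_indexRange_plus_iff hm]
  omega

theorem ncard_indexRange_hole {d m : ℕ} (hm : 2 * m + 1 ≤ d) :
    (indexRange d ((m : ℤ) + 1) ((d : ℤ) - ((m : ℤ) + 1))).ncard = d - (2 * m + 1) := by
  rw [indexRange, Set.InjOn.ncard_image, ← Finset.coe_Icc, Set.ncard_coe_finset, Int.card_Icc]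
  · omega
  · rintro i ⟨hi, hi'⟩ j ⟨hj, hj'⟩ h
    have h' := (ZMod.intCast_eq_intCast_iff' i j d).mp h
    rwa [Int.emod_eq_of_lt (by omega) (by omega), Int.emod_eq_of_lt (by omega) (by omega)] at h'

theorem ncard_holeSet {d m : ℕ} (hm : 2 * m + 1 ≤ d) :
    ((holeSet d m).ncard : ℝ) = ((d : ℝ) - 2 * m - 1) ^ 2 := by
  rw [holeSet, Set.ncard_prod, ncard_indexRange_hole hm, Nat.cast_mul, Nat.cast_sub hm]
  push_cast
  ring

/-- The side length of the hole is `c * d` up to a bounded rounding error, which disappears after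
division by `d`. -/
theorem tendsto_sq_div_sq {l : Filter ℕ} (hl : l ≤ atTop) {u : ℕ → ℝ} {c C : ℝ}
    (hu : ∀ᶠ d in l, |u d - c * d| ≤ C) :
    Tendsto (fun d => u d ^ 2 / (d : ℝ) ^ 2) l (𝓝 (c ^ 2)) := by
  have hC : Tendsto (fun d : ℕ => C / (d : ℝ)) l (𝓝 0) :=
    (tendsto_const_div_atTop_nhds_zero_nat C).mono_left hl
  have h1 : Tendsto (fun d : ℕ => u d / d - c) l (𝓝 0) := by
    refine squeeze_zero_norm' ?_ hC
    filter_upwards [hu, hl (eventually_gt_atTop 0)] with d hd hpos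
    have hd0 : (0 : ℝ) < d := Nat.cast_pos.mpr hpos
    rw [Real.norm_eq_abs, le_div_iff₀ hd0]
    calc |u d / d - c| * d = |(u d / d - c) * d| := by rw [abs_mul, abs_of_pos hd0]
      _ = |u d - c * d| := by rw [sub_mul, div_mul_cancel₀ _ hd0.ne']
      _ ≤ C := hd
  have h2 := (h1.add_const c).pow 2
  simpa only [sub_add_cancel, zero_add, div_pow] using h2

open Classical in
/-- The least integer above `mStar d`. -/
noncomputable def plusWidth (d : ℕ) : ℕ :=
  if d.Prime then (d - 1) / 4 + 1 else (d - 1) / 3 + 1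

theorem plusWidth_of_prime {d : ℕ} (hd : d.Prime) : plusWidth d = (d - 1) / 4 + 1 := if_pos hd

theorem plusWidth_of_not_prime {d : ℕ} (hd : ¬ d.Prime) : plusWidth d = (d - 1) / 3 + 1 :=
  if_neg hd

theorem two_mul_plusWidth_lt {d : ℕ} (hd : 6 ≤ d) : 2 * plusWidth d + 1 < d := by
  by_cases hp : d.Prime
  · rw [plusWidth_of_prime hp]
    omega
  · rw [plusWidth_of_not_prime hp]
    -- At `d = 7` the non-prime formula would give width 3 and an empty hole.
    have : d ≠ 7 := by rintro rfl; norm_num at hp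
    omega

theorem mStar_lt_plusWidth {d : ℕ} : mStar d < plusWidth d := by
  by_cases hp : d.Prime
  · rw [plusWidth_of_prime hp, mStar, if_pos hp, div_lt_iff₀ (by norm_num)]
    have : ((d : ℕ) : ℝ) < ((((d - 1) / 4 + 1) * 4 + 1 : ℕ) : ℝ) := Nat.cast_lt.mpr (by omega)
    push_cast at this ⊢
    linarith
  · rw [plusWidth_of_not_prime hp, mStar, if_neg hp, div_lt_iff₀ (by norm_num)]
    have : ((d : ℕ) : ℝ) < ((((d - 1) / 3 + 1) * 3 + 1 : ℕ) : ℝ) := Nat.cast_lt.mpr (by omega)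
    push_cast at this ⊢
    linarith

theorem four_mul_plusWidth_le {d : ℕ} (hd : d.Prime) : (4 * plusWidth d : ℝ) ≤ d + 3 := by
  have hpos := hd.pos
  have : 4 * plusWidth d ≤ d + 3 := by rw [plusWidth_of_prime hd]; omega
  exact_mod_cast this

theorem le_four_mul_plusWidth {d : ℕ} (hd : d.Prime) : (d : ℝ) ≤ 4 * plusWidth d := by
  exact_mod_cast four_mul_ge_of_prime hd mStar_lt_plusWidth

theorem three_mul_plusWidth_le {d : ℕ} (hd : ¬ d.Prime) (hpos : 0 < d) :
    (3 * plusWidth d : ℝ) ≤ d + 2 := by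
  have : 3 * plusWidth d ≤ d + 2 := by rw [plusWidth_of_not_prime hd]; omega
  exact_mod_cast this

theorem le_three_mul_plusWidth {d : ℕ} (hd : ¬ d.Prime) : (d : ℝ) ≤ 3 * plusWidth d := by
  exact_mod_cast three_mul_ge_of_not_prime hd mStar_lt_plusWidth

theorem sq_le_ncard_holeSet_of_prime {d : ℕ} (h6 : 6 ≤ d) (hd : d.Prime) :
    (((d : ℝ) - 5) / 2) ^ 2 ≤ ((holeSet d (plusWidth d)).ncard : ℝ) := by
  have h6' : (6 : ℝ) ≤ d := by exact_mod_cast h6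
  have := four_mul_plusWidth_le hd
  rw [ncard_holeSet (two_mul_plusWidth_lt h6).le]
  exact pow_le_pow_left₀ (by linarith) (by linarith) 2

theorem sq_le_ncard_holeSet {d : ℕ} (h6 : 6 ≤ d) :
    (((d : ℝ) - 7) / 3) ^ 2 ≤ ((holeSet d (plusWidth d)).ncard : ℝ) := by
  have h6' : (6 : ℝ) ≤ d := by exact_mod_cast h6
  by_cases hd : d.Prime
  · refine le_trans ?_ (sq_le_ncard_holeSet_of_prime h6 hd)
    exact sq_le_sq' (by linarith) (by linarith)
  · have := three_mul_plusWidth_le hd (by omega)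
    -- For `d = 6` the base `(d - 7) / 3` is negative, so squaring needs a two-sided bound.
    have h1 : (2 * plusWidth d + 1 + 1 : ℝ) ≤ d := by exact_mod_cast two_mul_plusWidth_lt h6
    rw [ncard_holeSet (two_mul_plusWidth_lt h6).le]
    exact sq_le_sq' (by linarith) (by linarith)

theorem tendsto_ncard_holeSet_of_prime :
    Tendsto (fun d : ℕ => ((holeSet d (plusWidth d)).ncard : ℝ) / (d : ℝ) ^ 2)
      (atTop ⊓ 𝓟 {d : ℕ | d.Prime}) (𝓝 (1 / 4)) := by
  have h := tendsto_sq_div_sq (l := atTop ⊓ 𝓟 {d : ℕ | d.Prime}) inf_le_left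
    (u := fun d => (d : ℝ) - 2 * plusWidth d - 1) (c := 1 / 2) (C := 3) ?_
  · rw [show (1 / 4 : ℝ) = (1 / 2) ^ 2 by norm_num]
    refine h.congr' ?_
    filter_upwards [inf_le_left (b := 𝓟 {d : ℕ | d.Prime}) (eventually_ge_atTop 6)] with d hd
    rw [ncard_holeSet (two_mul_plusWidth_lt hd).le]
  · filter_upwards [inf_le_right (a := atTop) (mem_principal_self {d : ℕ | d.Prime})] with d hd
    have h1 := four_mul_plusWidth_le hd
    have h2 := le_four_mul_plusWidth hd
    rw [abs_le]
    constructor <;> linarith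

theorem tendsto_ncard_holeSet_of_not_prime :
    Tendsto (fun d : ℕ => ((holeSet d (plusWidth d)).ncard : ℝ) / (d : ℝ) ^ 2)
      (atTop ⊓ 𝓟 {d : ℕ | ¬ d.Prime}) (𝓝 (1 / 9)) := by
  have h := tendsto_sq_div_sq (l := atTop ⊓ 𝓟 {d : ℕ | ¬ d.Prime}) inf_le_left
    (u := fun d => (d : ℝ) - 2 * plusWidth d - 1) (c := 1 / 3) (C := 3) ?_
  · rw [show (1 / 9 : ℝ) = (1 / 3) ^ 2 by norm_num]
    refine h.congr' ?_
    filter_upwards [inf_le_left (b := 𝓟 {d : ℕ | ¬ d.Prime}) (eventually_ge_atTop 6)] with d hd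
    rw [ncard_holeSet (two_mul_plusWidth_lt hd).le]
  · filter_upwards [inf_le_right (a := atTop) (mem_principal_self {d : ℕ | ¬ d.Prime}),
      inf_le_left (b := 𝓟 {d : ℕ | ¬ d.Prime}) (eventually_gt_atTop 0)] with d hd hpos
    have h1 := three_mul_plusWidth_le hd hpos
    have h2 := le_three_mul_plusWidth hd
    rw [abs_le]
    constructor <;> linarith

end STFTPhase

theorem mainTheorem1 :
    (∀ (d : ℕ) [NeZero d], 2 ≤ d → ∀ m : ℕ, STFTPhase.mStar d < (m : ℝ) →
      ∀ g : ZMod d → ℂ, STFTPhase.plusSet d m ⊆ Function.support (STFTPhase.stft g g) →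
        STFTPhase.DoesPhaseRetrieval g) ∧
    (∃ m : ℕ → ℕ,
      (∀ (d : ℕ) [NeZero d], 6 ≤ d →
        STFTPhase.mStar d < (m d : ℝ) ∧ (m d : ℝ) < ((d : ℝ) - 1) / 2 ∧
        STFTPhase.plusSet d (m d) = (STFTPhase.holeSet d (m d))ᶜ ∧
        (∀ g : ZMod d → ℂ,
          {p : ZMod d × ZMod d | STFTPhase.stft g g p = 0} ⊆ STFTPhase.holeSet d (m d) →
            STFTPhase.DoesPhaseRetrieval g) ∧
        (((d : ℝ) - 7) / 3) ^ 2 ≤ ((STFTPhase.holeSet d (m d)).ncard : ℝ) ∧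
        (d.Prime → (((d : ℝ) - 5) / 2) ^ 2 ≤ ((STFTPhase.holeSet d (m d)).ncard : ℝ))) ∧
      Tendsto (fun d : ℕ => ((STFTPhase.holeSet d (m d)).ncard : ℝ) / (d : ℝ) ^ 2)
        (atTop ⊓ 𝓟 {d : ℕ | ¬ d.Prime}) (𝓝 (1 / 9)) ∧
      Tendsto (fun d : ℕ => ((STFTPhase.holeSet d (m d)).ncard : ℝ) / (d : ℝ) ^ 2)
        (atTop ⊓ 𝓟 {d : ℕ | d.Prime}) (𝓝 (1 / 4))) := by
  refine ⟨fun d _ _ m hm g hg => STFTPhase.doesPhaseRetrieval_of_plusSet_subset hm hg,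
    STFTPhase.plusWidth, fun d _ hd => ?_, STFTPhase.tendsto_ncard_holeSet_of_not_prime,
    STFTPhase.tendsto_ncard_holeSet_of_prime⟩
  have hlt := STFTPhase.two_mul_plusWidth_lt hd
  have hcompl := STFTPhase.plusSet_eq_compl_holeSet hlt.le
  refine ⟨STFTPhase.mStar_lt_plusWidth, ?_, hcompl, fun g hg => ?_,
    STFTPhase.sq_le_ncard_holeSet hd, STFTPhase.sq_le_ncard_holeSet_of_prime hd⟩
  · have : (2 * STFTPhase.plusWidth d + 1 : ℝ) < d := by exact_mod_cast hlt
    linarith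
  · refine STFTPhase.doesPhaseRetrieval_of_plusSet_subset STFTPhase.mStar_lt_plusWidth ?_
    rw [hcompl]
    exact fun p hp h0 => hp (hg h0)
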